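/- Let $T$ be a (not necessarily complete) first-order theory in a one-sorted language and let $M \models T$. "Definable" means definable in $M$ with parameters. An \emph{interpretable set} of $M$ is a quotient $X = D/E$ of a definable set $D \subseteq M^n$ by a definable equivalence relation $E$ on $D$; a subset of a product of interpretable sets is definable if its preimage in the corresponding power of $M$ is. We say that \emph{$\exists^\infty$ is eliminated on $X$} if for every definable family $\{D_a\}_{a \in Y}$ of subsets of $X$, indexed by an interpretable set $Y$, there is an $n \in \mathbb{N}$ such that for all $a \in Y$, \[ |D_a| = \infty \iff |D_a| > n. \] An interpretable set $X$ is a \emph{set of unary imaginaries} if there is a definable relation $R \subseteq X \times M$ such that the map $x \mapsto R_x := \{m \in M : (x,m) \in R\}$ is injective on $X$. \textbf{Theorem.} Suppose that, in every model of $T$, $\exists^\infty$ is eliminated on every set of unary imaginaries. Then $T^{\mathrm{eq}}$ eliminates $\exists^\infty$, that is, in every model of $T$, $\exists^\infty$ is eliminated on every interpretable set. In fact this holds model by model: if $M \models T$ and $\exists^\infty$ is eliminated on every set of unary imaginaries in $M$, then $\exists^\infty$ is eliminated on every interpretable set in $M$. -/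

import Mathlib

open FirstOrder

universe u v w

namespace FirstOrder.Language

/-- An interpretable set of the one-sorted `L`-structure `M`: the quotient of a definable set
`dom ⊆ M ^ arity` by a definable equivalence relation on `dom`. Here and below, "definable" means
definable with parameters from `M`. Up to definable bijection these are exactly the definable sets
of `M^eq`. -/
structure InterpretableSet (L : Language.{u, v}) (M : Type w) [L.Structure M] where
  /-- the number of coordinates -/
  arity : ℕ
  /-- the definable set of which a quotient is taken -/
  dom : Set (Fin arity → M)
  dom_definable : (Set.univ : Set M).Definable L dom
  /-- the equivalence relation on `dom` -/
  rel : Setoid dom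
  rel_definable : (Set.univ : Set M).Definable L
    {p : Fin arity ⊕ Fin arity → M |
      ∃ (hx : (fun i => p (Sum.inl i)) ∈ dom) (hy : (fun i => p (Sum.inr i)) ∈ dom),
        rel ⟨fun i => p (Sum.inl i), hx⟩ ⟨fun i => p (Sum.inr i), hy⟩}

namespace InterpretableSet

variable {L : Language.{u, v}} {M : Type w} [L.Structure M]

/-- The elements of an interpretable set. -/
def Points (X : InterpretableSet L M) : Type w := Quotient X.rel

/-- The element of `X` represented by a tuple of its domain. -/
def pt (X : InterpretableSet L M) (x : Fin X.arity → M) (hx : x ∈ X.dom) : X.Points :=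
  Quotient.mk X.rel ⟨x, hx⟩

/-- A family `(D a)`, `a ∈ Y`, of subsets of `X` indexed by an interpretable set `Y` is a definable
family if the relation `x ∈ D a` is definable, i.e. if its pullback to the tuples that represent
the elements of `Y` and of `X` is definable. -/
def IsDefinableFamily (Y X : InterpretableSet L M) (D : Y.Points → Set X.Points) : Prop :=
  (Set.univ : Set M).Definable L
    {p : Fin Y.arity ⊕ Fin X.arity → M |
      ∃ (ha : (fun i => p (Sum.inl i)) ∈ Y.dom) (hx : (fun i => p (Sum.inr i)) ∈ X.dom),
        X.pt (fun i => p (Sum.inr i)) hx ∈ D (Y.pt (fun i => p (Sum.inl i)) ha)}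

/-- `∃^∞` is eliminated on `X`: in every definable family of subsets of `X` there is a finite
bound on the size of the finite members. -/
def EliminatesExistsInfty (X : InterpretableSet L M) : Prop :=
  ∀ (Y : InterpretableSet L M) (D : Y.Points → Set X.Points), IsDefinableFamily Y X D →
    ∃ n : ℕ, ∀ a : Y.Points, (D a).Infinite ↔ (n : ℕ∞) < (D a).encard

/-- A relation `R ⊆ X × M` is definable if its pullback to `M ^ arity × M` is. -/
def IsDefinableHomeRel (X : InterpretableSet L M) (R : X.Points → M → Prop) : Prop :=
  (Set.univ : Set M).Definable L
    {p : Fin X.arity ⊕ Unit → M |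
      ∃ hx : (fun i => p (Sum.inl i)) ∈ X.dom,
        R (X.pt (fun i => p (Sum.inl i)) hx) (p (Sum.inr ()))}

/-- `X` is a set of unary imaginaries: for some definable `R ⊆ X × M`, the map that sends `x` to
`R_x = {m ∈ M : (x, m) ∈ R}` is injective. -/
def IsSetOfUnaryImaginaries (X : InterpretableSet L M) : Prop :=
  ∃ R : X.Points → M → Prop, X.IsDefinableHomeRel R ∧
    Function.Injective fun x : X.Points => {m : M | R x m}

end InterpretableSet

/-- In the structure `M`, `∃^∞` is eliminated on every set of unary imaginaries. -/
def EliminatesOnUnaryImaginaries (L : Language.{u, v}) (M : Type w) [L.Structure M] : Prop :=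
  ∀ X : InterpretableSet L M, X.IsSetOfUnaryImaginaries → X.EliminatesExistsInfty

/-- `M^eq` eliminates `∃^∞`: it is eliminated on every interpretable set of `M`. -/
def EqEliminates (L : Language.{u, v}) (M : Type w) [L.Structure M] : Prop :=
  ∀ X : InterpretableSet L M, X.EliminatesExistsInfty

namespace Theory

variable {L : Language.{u, v}}

/-- `∃^∞` is eliminated on every set of unary imaginaries in every model of `T`. The universe is
large enough for a consistent `T` to have models in it. -/
def EliminatesOnUnaryImaginaries (T : L.Theory) : Prop :=
  ∀ (M : Type (max u v w)) [L.Structure M] [Nonempty M], M ⊨ T →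
    L.EliminatesOnUnaryImaginaries M

/-- `T^eq` eliminates `∃^∞`: it is eliminated on every interpretable set in every model of `T`. -/
def EqEliminates (T : L.Theory) : Prop :=
  ∀ (M : Type (max u v w)) [L.Structure M] [Nonempty M], M ⊨ T → L.EqEliminates M

end Theory

end FirstOrder.Language

/-!
`L`-definable families of subsets of `M ^ n` are treated directly as relations
`R : (β → M) → Set (Fin n → M)` on tuples, so that the imaginaries coded by a family are simply its
members `R x`, and no quotient has to be formed. `FiniteMembersBounded n` says that in a uniformly
definable family of collections `{R x | x ∈ P a}` of subsets of `M ^ n`, the finite collections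
have bounded size. For `n = 1` this follows from elimination of `∃^∞` on the sets of unary
imaginaries, and if it holds for all `n` then `∃^∞` is eliminated on every interpretable set,
because an element of a quotient of `D ⊆ M ^ n` is a subset of `M ^ n`.

It remains to pass from `n` to `n + 1`. A subset `R x` of `M ^ (n + 1)` is a function `f_x` on `M`
whose values are subsets of `M ^ n`, namely the fibres of `R x`. If a collection of such functions
is finite, then

* for each `m`, the functions take finitely many values at `m`, hence at most `N` by induction;
* there are finitely many sets `{m | f_x m = f_y m}`, hence at most `K` by the unary case.

Conversely, these two bounds limit the size of the collection (`encard_le_of_agreement_sets`): the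
agreement sets cut `M` into at most `2 ^ K` cells on each of which agreement of two of the
functions is constant, so that a function of the collection is determined by its values at one
point of each cell.
-/

/-! ### Counting functions by their agreement sets -/

namespace Set

/-- A set `F` of functions is bounded in size by the number `N` of values at each point and the
number `K` of agreement sets `{m | f m = g m}`. -/
theorem encard_le_of_agreement_sets {A T : Type*} (F : Set (A → T)) (N K : ℕ)
    (hN : ∀ m, ((fun f : A → T => f m) '' F).encard ≤ N)
    (hK : (image2 (fun f g : A → T => {m | f m = g m}) F F).encard ≤ K) :
    F.encard ≤ ((N + 1) ^ 2 ^ K : ℕ) := by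
  classical
  set E := image2 (fun f g : A → T => {m | f m = g m}) F F with hE
  -- The codomain `Fin (N + 1)` is nonempty even for `N = 0`; `Φ` below needs a default value.
  have hcode : ∀ m, ∃ c : T → Fin N.succ, InjOn c ((fun f : A → T => f m) '' F) := by
    intro m
    obtain ⟨c, -, hc⟩ := (finite_of_encard_le_coe (hN m)).exists_injOn_of_encard_le
      (t := (univ : Set (Fin N.succ))) ((hN m).trans (by simp [encard_univ]))
    exact ⟨c, hc⟩
  choose code hcode using hcode
  have hfin : E.Finite := finite_of_encard_le_coe hK
  have : Fintype E := hfin.fintype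
  have hcard : Fintype.card E ≤ K := by
    rw [← Nat.card_eq_fintype_card, ← Nat.cast_le (α := ℕ∞)]
    rwa [encard, ENat.card_eq_coe_natCard] at hK
  -- The cell of `m` is recorded by the agreement sets that contain `m`.
  let cell : A → E → Bool := fun m e => decide (m ∈ e.1)
  let Φ : (A → T) → (E → Bool) → Fin N.succ := fun f c =>
    if h : ∃ m, cell m = c then code h.choose (f h.choose) else 0
  have hΦ : InjOn Φ F := by
    intro f hf g hg hfg
    funext m
    have hex : ∃ m', cell m' = cell m := ⟨m, rfl⟩
    have h1 : f hex.choose = g hex.choose := by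
      have := congrFun hfg (cell m)
      simp only [Φ, dif_pos hex] at this
      exact hcode _ ⟨f, hf, rfl⟩ ⟨g, hg, rfl⟩ this
    have h2 := congrFun hex.choose_spec ⟨_, mem_image2_of_mem hf hg⟩
    simpa [cell, h1] using h2
  calc F.encard = (Φ '' F).encard := hΦ.encard_image.symm
    _ ≤ (univ : Set ((E → Bool) → Fin N.succ)).encard := encard_le_encard (subset_univ _)
    _ = ((N + 1) ^ 2 ^ Fintype.card E : ℕ) := by
      rw [encard_univ, ENat.card_eq_coe_fintype_card, Fintype.card_fun, Fintype.card_fun,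
        Fintype.card_bool, Fintype.card_fin]
    _ ≤ ((N + 1) ^ 2 ^ K : ℕ) := by
      exact_mod_cast Nat.pow_le_pow_right N.succ_pos (Nat.pow_le_pow_right two_pos hcard)

end Set

namespace FirstOrder.Language

open Set

variable {L : Language.{u, v}} {M : Type w} [L.Structure M]

/-! ### Bounded families of subsets of `M ^ n` -/

theorem _root_.Set.Definable.of_mem_iff {A : Set M} {α : Type*} {s t : Set (α → M)}
    (hs : A.Definable L s) (h : ∀ p, p ∈ s ↔ p ∈ t) : A.Definable L t :=
  Set.ext h ▸ hs

theorem definable_eq_coord {A : Set M} {α : Type*} (i j : α) :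
    A.Definable L {p : α → M | p i = p j} :=
  ⟨(Term.var i).equal (Term.var j), by ext p; simp [Formula.realize_equal]⟩

/-- If `R x` is a definable family of sets of tuples, then `R x = R y` is a definable relation. -/
theorem definable_family_eq {A : Set M} {β γ : Type*} [Finite γ]
    {R : (β → M) → Set (γ → M)}
    (hR : A.Definable L {p : β ⊕ γ → M | (fun i => p (.inr i)) ∈ R fun i => p (.inl i)}) :
    A.Definable L
      {p : β ⊕ β → M | R (fun i => p (.inl i)) = R fun i => p (.inr i)} := by
  have h1 := hR.preimage_comp (Sum.map Sum.inl id : β ⊕ γ → (β ⊕ β) ⊕ γ)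
  have h2 := hR.preimage_comp (Sum.map Sum.inr id : β ⊕ γ → (β ⊕ β) ⊕ γ)
  convert ((h1.himp h2).inter (h2.himp h1)).forall_of_finite using 1
  ext p
  simp [Set.ext_iff, iff_iff_implies_and_implies, himp_eq, imp_iff_or_not]

variable (L M) in
/-- In every uniformly definable family `{R x | x ∈ P a}` of collections of definable subsets of
`M ^ n`, the finite collections have bounded size. The tuples `a` and `x` are indexed by arbitrary
finite types, and indices `x` with the same `R x` are identified by taking the image under `R`, so
that this speaks of interpretable sets without forming quotients. -/
def FiniteMembersBounded (n : ℕ) : Prop :=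
  ∀ (α β : Type) [Finite α] [Finite β]
    (P : (α → M) → Set (β → M)) (R : (β → M) → Set (Fin n → M)),
    (univ : Set M).Definable L
      {p : α ⊕ β → M | (fun i => p (.inr i)) ∈ P fun i => p (.inl i)} →
    (univ : Set M).Definable L
      {p : β ⊕ Fin n → M | (fun i => p (.inr i)) ∈ R fun i => p (.inl i)} →
    ∃ N : ℕ, ∀ a, (R '' P a).Finite → (R '' P a).encard ≤ N

theorem finiteMembersBounded_zero : FiniteMembersBounded L M 0 := by
  intro α β _ _ P R _ _
  have : Finite (Set (Fin 0 → M)) := inferInstance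
  refine ⟨(univ : Set (Set (Fin 0 → M))).ncard, fun a _ => ?_⟩
  rw [finite_univ.cast_ncard_eq]
  exact encard_le_encard (subset_univ _)

theorem FiniteMembersBounded.succ {n : ℕ} (h1 : FiniteMembersBounded L M 1)
    (hn : FiniteMembersBounded L M n) : FiniteMembersBounded L M (n + 1) := by
  intro α β _ _ P R hP hR
  -- The values at `m` of the functions in the collection `a`, as a family indexed by `(a, m)`.
  obtain ⟨N, hN⟩ := hn (α ⊕ Unit) (β ⊕ Unit)
    (fun a => {x | (fun i => x (.inl i)) ∈ P (fun i => a (.inl i)) ∧ x (.inr ()) = a (.inr ())})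
    (fun x => {z | (Fin.cons (x (.inr ())) z : Fin (n + 1) → M) ∈ R fun i => x (.inl i)})
    ((hP.preimage_comp (Sum.map Sum.inl Sum.inl)).inter
      (definable_eq_coord (Sum.inr (Sum.inr ())) (Sum.inl (Sum.inr ()))))
    (by
      convert hR.preimage_comp (Sum.elim (fun i => .inl (.inl i))
        (Fin.cons (.inl (.inr ())) .inr) : β ⊕ Fin (n + 1) → (β ⊕ Unit) ⊕ Fin n) using 1
      ext p
      simp only [mem_ofPred_eq, mem_preimage, Function.comp_def, Sum.elim_inl, Sum.elim_inr]
      congr! 2 with i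
      refine Fin.cases ?_ (fun j => ?_) i <;> simp)
  -- The agreement sets of two functions in the collection `a`.
  obtain ⟨K, hK⟩ := h1 α (β ⊕ β)
    (fun a => {x | (fun i => x (.inl i)) ∈ P a ∧ (fun i => x (.inr i)) ∈ P a})
    (fun x => {m | {z | (Fin.cons (m 0) z : Fin (n + 1) → M) ∈ R fun i => x (.inl i)} =
      {z | (Fin.cons (m 0) z : Fin (n + 1) → M) ∈ R fun i => x (.inr i)}})
    ((hP.preimage_comp (Sum.map id Sum.inl)).inter (hP.preimage_comp (Sum.map id Sum.inr)))
    (by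
      have h : (univ : Set M).Definable L
          {p : (β ⊕ Fin 1) ⊕ Fin n → M | (fun i => p (.inr i)) ∈
            {z | (Fin.cons (p (.inl (.inr 0))) z : Fin (n + 1) → M) ∈
              R fun i => p (.inl (.inl i))}} := by
        convert hR.preimage_comp (Sum.elim (fun i => .inl (.inl i))
          (Fin.cons (.inl (.inr 0)) .inr) : β ⊕ Fin (n + 1) → (β ⊕ Fin 1) ⊕ Fin n) using 1
        ext p
        simp only [mem_ofPred_eq, mem_preimage, Function.comp_def, Sum.elim_inl, Sum.elim_inr]
        congr! 2 with i
        refine Fin.cases ?_ (fun j => ?_) i <;> simp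
      exact (definable_family_eq (R := fun q : β ⊕ Fin 1 → M =>
          {z : Fin n → M | (Fin.cons (q (.inr 0)) z : Fin (n + 1) → M) ∈
            R fun i => q (.inl i)}) h).preimage_comp
        (Sum.elim (Sum.map Sum.inl id) (Sum.map Sum.inr id) :
          (β ⊕ Fin 1) ⊕ (β ⊕ Fin 1) → (β ⊕ β) ⊕ Fin 1))
  refine ⟨(N + 1) ^ 2 ^ K, fun a ha => ?_⟩
  let curry : Set (Fin (n + 1) → M) → M → Set (Fin n → M) := fun s m => {z | Fin.cons m z ∈ s}
  have hcurry : Function.Injective curry := by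
    intro s t hst
    ext z
    have := congrArg (fun u => Fin.tail z ∈ u) (congrFun hst (z 0))
    simpa [curry] using this
  rw [← hcurry.encard_image]
  have hF : (curry '' (R '' P a)).Finite := ha.image _
  apply encard_le_of_agreement_sets
  · intro m
    convert hN (Sum.elim a fun _ => m) ?_ using 2
    rotate_left
    · refine (hF.image fun f => f m).subset ?_
      rintro _ ⟨x, ⟨hx, hm⟩, rfl⟩
      simp only [Sum.elim_inl, Sum.elim_inr] at hx hm
      exact ⟨_, ⟨_, ⟨_, hx, rfl⟩, rfl⟩, by simp [curry, hm]⟩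
    · ext s
      constructor
      · rintro ⟨_, ⟨_, ⟨x, hx, rfl⟩, rfl⟩, rfl⟩
        exact ⟨Sum.elim x fun _ => m, ⟨hx, rfl⟩, rfl⟩
      · rintro ⟨x, ⟨hx, hm⟩, rfl⟩
        simp only [Sum.elim_inl, Sum.elim_inr] at hx hm
        exact ⟨_, ⟨_, ⟨_, hx, rfl⟩, rfl⟩, by simp [curry, hm]⟩
  · refine le_trans ?_ (hK a ?_)
    · refine (encard_le_encard ?_).trans
        (encard_image_le (fun u : Set (Fin 1 → M) => {m | (fun _ => m) ∈ u}) _)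
      rintro _ ⟨_, ⟨_, ⟨x, hx, rfl⟩, rfl⟩, _, ⟨_, ⟨y, hy, rfl⟩, rfl⟩, rfl⟩
      exact ⟨_, ⟨Sum.elim x y, ⟨hx, hy⟩, rfl⟩, rfl⟩
    · refine (hF.image2 (fun f g => {m : Fin 1 → M | f (m 0) = g (m 0)}) hF).subset ?_
      rintro _ ⟨x, ⟨hx, hy⟩, rfl⟩
      exact ⟨_, ⟨_, ⟨_, hx, rfl⟩, rfl⟩, _, ⟨_, ⟨_, hy, rfl⟩, rfl⟩, rfl⟩

/-! ### Imaginaries coded by definable families -/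

namespace InterpretableSet

/-- The set of imaginaries coded by a definable family `R x` of sets of tuples: the tuples `x`
modulo `R x = R y`. -/
def ofFamily {k : ℕ} {γ : Type*} [Finite γ] (R : (Fin k → M) → Set (γ → M))
    (hR : (univ : Set M).Definable L
      {p : Fin k ⊕ γ → M | (fun i => p (.inr i)) ∈ R fun i => p (.inl i)}) :
    InterpretableSet L M where
  arity := k
  dom := univ
  dom_definable := definable_univ
  rel := Setoid.ker fun x => R x.1
  rel_definable := by
    convert definable_family_eq hR using 1
    ext p
    simp

section ofFamily

variable {k : ℕ} {γ : Type*} [Finite γ] {R : (Fin k → M) → Set (γ → M)}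
  {hR : (univ : Set M).Definable L
      {p : Fin k ⊕ γ → M | (fun i => p (.inr i)) ∈ R fun i => p (.inl i)}}

/-- The set of tuples coded by a point of `ofFamily R`. -/
def decode (x : (ofFamily R hR).Points) : Set (γ → M) :=
  Quotient.lift (fun t : (ofFamily R hR).dom => R t.1) (fun _ _ h => h) x

@[simp]
theorem decode_pt (t : Fin k → M) (ht) : decode ((ofFamily R hR).pt t ht) = R t := rfl

theorem decode_injective : Function.Injective (decode (hR := hR)) := by
  rintro ⟨x⟩ ⟨y⟩ h
  exact Quotient.sound h

theorem range_decode : range (decode (hR := hR)) = range R := by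
  ext s
  constructor
  · rintro ⟨⟨x⟩, rfl⟩
    exact ⟨x.1, rfl⟩
  · rintro ⟨x, rfl⟩
    exact ⟨(ofFamily R hR).pt x (mem_univ x), rfl⟩

end ofFamily

theorem isSetOfUnaryImaginaries_ofFamily {k : ℕ} {R : (Fin k → M) → Set (Fin 1 → M)}
    (hR : (univ : Set M).Definable L
      {p : Fin k ⊕ Fin 1 → M | (fun i => p (.inr i)) ∈ R fun i => p (.inl i)}) :
    (ofFamily R hR).IsSetOfUnaryImaginaries := by
  refine ⟨fun x m => (fun _ => m) ∈ decode x, ?_, fun x y hxy => decode_injective ?_⟩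
  · unfold IsDefinableHomeRel
    refine (hR.preimage_comp
      (Sum.map id fun _ => () : Fin k ⊕ Fin 1 → Fin k ⊕ Unit)).of_mem_iff fun p => ?_
    constructor
    · exact fun h => ⟨mem_univ _, h⟩
    · rintro ⟨_, h⟩
      exact h
  · ext z
    have := congrArg (fun u => z 0 ∈ u) hxy
    have hz : (fun _ => z 0) = z := funext fun i => by rw [Subsingleton.elim i 0]
    simpa [hz] using this

end InterpretableSet

/-! ### Elimination of `∃^∞` -/

open InterpretableSet

theorem EliminatesOnUnaryImaginaries.finiteMembersBounded_one
    (h : L.EliminatesOnUnaryImaginaries M) : FiniteMembersBounded L M 1 := by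
  intro α β _ _ P R hP hR
  obtain ⟨k, ⟨d⟩⟩ := Finite.exists_equiv_fin α
  obtain ⟨l, ⟨e⟩⟩ := Finite.exists_equiv_fin β
  let P' : (Fin k → M) → Set (Fin l → M) := fun a => {x | x ∘ e ∈ P (a ∘ d)}
  let R' : (Fin l → M) → Set (Fin 1 → M) := fun x => R (x ∘ e)
  have hP' : (univ : Set M).Definable L
      {p : Fin k ⊕ Fin l → M | (fun i => p (.inr i)) ∈ P' fun i => p (.inl i)} :=
    hP.preimage_comp (Sum.map d e)
  have hR' : (univ : Set M).Definable L
      {p : Fin l ⊕ Fin 1 → M | (fun i => p (.inr i)) ∈ R' fun i => p (.inl i)} :=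
    hR.preimage_comp (Sum.map e id)
  let D : (ofFamily P' hP').Points → Set (ofFamily R' hR').Points :=
    fun a => decode ⁻¹' (R' '' decode a)
  have hD : IsDefinableFamily _ _ D := by
    unfold IsDefinableFamily
    have h1 := hP'.preimage_comp
      (Sum.map Sum.inl id : Fin k ⊕ Fin l → (Fin k ⊕ Fin l) ⊕ Fin l)
    have h2 := (definable_family_eq hR').preimage_comp
      (Sum.elim Sum.inr fun i => .inl (.inr i) : Fin l ⊕ Fin l → (Fin k ⊕ Fin l) ⊕ Fin l)
    refine (h1.inter h2).exists_of_finite.of_mem_iff fun p => ?_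
    constructor
    · rintro ⟨t, ht, htp⟩
      exact ⟨mem_univ _, mem_univ _, t, ht, htp⟩
    · rintro ⟨_, _, t, ht, htp⟩
      exact ⟨t, ht, htp⟩
  obtain ⟨N, hN⟩ := h _ (isSetOfUnaryImaginaries_ofFamily hR') _ D hD
  refine ⟨N, fun a ha => ?_⟩
  have himage : R '' P a = R' '' P' (a ∘ d.symm) := by
    ext s
    constructor
    · rintro ⟨x, hx, rfl⟩
      refine ⟨x ∘ e.symm, ?_, ?_⟩
      · simpa [P', Function.comp_assoc] using hx
      · simp [R', Function.comp_assoc]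
    · rintro ⟨x, hx, rfl⟩
      exact ⟨x ∘ e, by simpa [P', Function.comp_assoc] using hx, rfl⟩
  let b := (ofFamily P' hP').pt (a ∘ d.symm) (mem_univ _)
  have hb : decode '' D b = R '' P a := by
    rw [himage, image_preimage_eq_of_subset]
    · rfl
    · rw [range_decode]
      exact image_subset_range _ _
  rw [← hb] at ha ⊢
  rw [decode_injective.encard_image]
  refine not_lt.1 fun hlt => (hN b).2 hlt ?_
  exact ha.of_finite_image decode_injective.injOn

/-- An element of a quotient of `D ⊆ M ^ n` is a subset of `M ^ n`, namely an equivalence class. -/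
theorem eqEliminates_of_finiteMembersBounded (h : ∀ n, FiniteMembersBounded L M n) :
    L.EqEliminates M := by
  intro X Y D hD
  let P : (Fin Y.arity → M) → Set (Fin X.arity → M) := fun a =>
    {x | ∃ (ha : a ∈ Y.dom) (hx : x ∈ X.dom), X.pt x hx ∈ D (Y.pt a ha)}
  let R : (Fin X.arity → M) → Set (Fin X.arity → M) := fun x =>
    {y | ∃ (hx : x ∈ X.dom) (hy : y ∈ X.dom), X.rel ⟨x, hx⟩ ⟨y, hy⟩}
  obtain ⟨N, hN⟩ := h X.arity _ _ P R hD X.rel_definable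
  refine ⟨N, fun a => ⟨fun ha => ?_, fun hlt hfin => hlt.not_ge ?_⟩⟩
  · rw [ha.encard_eq]
    exact ENat.natCast_lt_top N
  · obtain ⟨⟨a, ha⟩, rfl⟩ := Quotient.exists_rep a
    let cls : X.Points → Set (Fin X.arity → M) := fun x =>
      {y | ∃ hy : y ∈ X.dom, X.pt y hy = x}
    have hcls : Function.Injective cls := by
      rintro ⟨x⟩ x' hxx'
      have : x.1 ∈ cls x' := hxx' ▸ ⟨x.2, rfl⟩
      exact this.2
    have hR : ∀ x (hx : x ∈ X.dom), R x = cls (X.pt x hx) := by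
      intro x hx
      ext y
      constructor
      · rintro ⟨_, hy, hxy⟩
        exact ⟨hy, Quotient.sound (X.rel.symm hxy)⟩
      · rintro ⟨hy, hxy⟩
        exact ⟨hx, hy, X.rel.symm (Quotient.exact hxy)⟩
    have himage : R '' P a = cls '' D (Y.pt a ha) := by
      ext s
      constructor
      · rintro ⟨x, ⟨_, hx, hxa⟩, rfl⟩
        exact ⟨_, hxa, (hR x hx).symm⟩
      · rintro ⟨⟨x, hx⟩, hxa, rfl⟩
        exact ⟨x, ⟨ha, hx, hxa⟩, hR x hx⟩
    have := hN a (himage ▸ hfin.image cls)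
    rwa [himage, hcls.encard_image] at this

theorem EliminatesOnUnaryImaginaries.eqEliminates (h : L.EliminatesOnUnaryImaginaries M) :
    L.EqEliminates M := by
  refine eqEliminates_of_finiteMembersBounded fun n => ?_
  induction n with
  | zero => exact finiteMembersBounded_zero
  | succ n ih => exact h.finiteMembersBounded_one.succ ih

end FirstOrder.Language

theorem theorem1 {L : FirstOrder.Language.{u, v}} (T : L.Theory) :
    (FirstOrder.Language.Theory.EliminatesOnUnaryImaginaries.{u, v, w} T →
      FirstOrder.Language.Theory.EqEliminates.{u, v, w} T) ∧
    (∀ (M : Type w) [L.Structure M] [Nonempty M], M ⊨ T →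
      L.EliminatesOnUnaryImaginaries M → L.EqEliminates M) :=
  ⟨fun h M _ _ hM => (h M hM).eqEliminates, fun _ _ _ _ h => h.eqEliminates⟩
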